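/- **Theorem (blow-up for $1<p<5$).** Let $1<p<5$ and let $u_0,u_1\in C_0^\infty(\mathbb R)$ be real-valued with $u_i\ge 0$ and $u_i\not\equiv 0$ for $i=0,1$. Then the Cauchy problem $$\partial_t^2u-t\,\partial_x^2u=|u|^p\quad\text{in }(0,\infty)\times\mathbb R,\qquad u(0,x)=u_0(x),\quad \partial_tu(0,x)=u_1(x)$$ admits no real-valued global weak solution $u\in C([0,\infty),H^1(\mathbb R))\cap C^1([0,\infty),L^2(\mathbb R))$. Here $u$ in this class is called a global weak solution if for every $\varphi\in C_0^\infty(\mathbb R^2)$ $$\int_0^\infty\!\!\int_{\mathbb R}u\,\bigl(\partial_t^2\varphi-t\,\partial_x^2\varphi\bigr)\,dx\,dt=\int_0^\infty\!\!\int_{\mathbb R}|u|^p\varphi\,dx\,dt+\int_{\mathbb R}u_1(x)\,\varphi(0,x)\,dx-\int_{\mathbb R}u_0(x)\,\partial_t\varphi(0,x)\,dx .$$ -/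

import Mathlib

open Set MeasureTheory
open scoped ContDiff

/-- The real Hilbert space `L²(ℝ)` (Lebesgue measure). -/
abbrev L2R : Type := Lp ℝ 2 (volume : Measure ℝ)

/-- `g` is the weak derivative of `f` on `ℝ`:
`∫ f ψ' = - ∫ g ψ` for all smooth compactly supported `ψ`. -/
def IsWeakDeriv (f g : L2R) : Prop :=
  ∀ ψ : ℝ → ℝ, ContDiff ℝ ∞ ψ → HasCompactSupport ψ →
    ∫ x, f x * deriv ψ x = - ∫ x, g x * ψ x

theorem integrable_L2R_mul (f : L2R) {ψ : ℝ → ℝ} (hψ : Continuous ψ)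
    (hc : HasCompactSupport ψ) : Integrable (fun x => f x * ψ x) :=
  MemLp.integrable_mul (p := 2) (q := 2) (Lp.memLp f) (hψ.memLp_of_hasCompactSupport hc)

/-- The Sobolev space `H¹(ℝ)`: pairs `(f, f')` in `L² × L²` whose second component is the weak
derivative of the first. Its norm is the usual one, `‖f‖² = ‖f‖_{L²}² + ‖f'‖_{L²}²`. -/
noncomputable def H1R : Submodule ℝ (WithLp 2 (L2R × L2R)) where
  carrier := {w | IsWeakDeriv w.fst w.snd}
  zero_mem' := by
    intro ψ _ _
    have h1 : ∀ θ : ℝ → ℝ, ∫ x, (0 : L2R) x * θ x = 0 := fun θ => by simp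
    change ∫ x, (0 : L2R) x * deriv ψ x = - ∫ x, (0 : L2R) x * ψ x
    rw [h1, h1, neg_zero]
  add_mem' := by
    intro a b ha hb ψ hψ hc
    have hd : Continuous (deriv ψ) := hψ.continuous_deriv (by simp)
    have key : ∀ (f g : L2R) (θ : ℝ → ℝ), Continuous θ → HasCompactSupport θ →
        ∫ x, (f + g : L2R) x * θ x = (∫ x, f x * θ x) + ∫ x, g x * θ x := by
      intro f g θ hθ hcθ
      rw [← integral_add (integrable_L2R_mul f hθ hcθ) (integrable_L2R_mul g hθ hcθ)]
      apply integral_congr_ae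
      filter_upwards [Lp.coeFn_add f g] with x hx
      rw [hx, Pi.add_apply, add_mul]
    change ∫ x, (a.fst + b.fst : L2R) x * deriv ψ x = - ∫ x, (a.snd + b.snd : L2R) x * ψ x
    rw [key _ _ _ hd hc.deriv, key _ _ _ hψ.continuous hc, ha ψ hψ hc, hb ψ hψ hc, neg_add]
  smul_mem' := by
    intro c a ha ψ hψ hc
    have key : ∀ (f : L2R) (θ : ℝ → ℝ),
        ∫ x, (c • f : L2R) x * θ x = c * ∫ x, f x * θ x := by
      intro f θ
      rw [← integral_const_mul]
      apply integral_congr_ae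
      filter_upwards [Lp.coeFn_smul c f] with x hx
      rw [hx, Pi.smul_apply, smul_eq_mul, mul_assoc]
    change ∫ x, (c • a.fst : L2R) x * deriv ψ x = - ∫ x, (c • a.snd : L2R) x * ψ x
    rw [key, key, ha ψ hψ hc, mul_neg]

/-- The underlying `L²` function of an element of `H¹(ℝ)`. -/
noncomputable def toL2 (w : H1R) : L2R := (w : WithLp 2 (L2R × L2R)).fst

/-- `u` is a global weak solution, in `C([0,∞), H¹(ℝ)) ∩ C¹([0,∞), L²(ℝ))`, of the Cauchy problem
`∂ₜ²u - t ∂ₓ²u = |u|^p` for `t > 0`, `x ∈ ℝ`, with `u(0,·) = u₀` and `∂ₜu(0,·) = u₁`.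
Only the values `u t` with `t ≥ 0` matter. The equation and the initial conditions are both
expressed by the integral identity, whose test functions `φ(t,x)` are smooth and compactly
supported in the plane, and need not vanish at `t = 0`. All the integrals converge absolutely,
because the elements of `H¹(ℝ)` are bounded functions. -/
structure IsGlobalWeakSolution (p : ℝ) (u₀ u₁ : ℝ → ℝ) (u : ℝ → H1R) : Prop where
  continuous_H1 : ContinuousOn u (Ici 0)
  contDiff_L2 : ContDiffOn ℝ 1 (fun t => toL2 (u t)) (Ici 0)
  weak_eq : ∀ φ : ℝ × ℝ → ℝ, ContDiff ℝ ∞ φ → HasCompactSupport φ →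
    ∫ t in Ioi (0 : ℝ), ∫ x, toL2 (u t) x *
        (iteratedDeriv 2 (fun s => φ (s, x)) t - t * iteratedDeriv 2 (fun y => φ (t, y)) x)
      = (∫ t in Ioi (0 : ℝ), ∫ x, |toL2 (u t) x| ^ p * φ (t, x))
        + (∫ x, u₁ x * φ (0, x)) - ∫ x, u₀ x * deriv (fun s => φ (s, x)) 0

/-! The proof is the test function method. Let `χ` be a smooth cutoff, equal to `1` on `[-1, 1]` and
supported in `[-2, 2]`, such that `|χ''| ≤ C χ^(1/p)` (`exists_cutoff`). The test function
`φ(t, x) = χ(ε² t) χ(ε³ x)` respects the scaling of `∂ₜ² - t ∂ₓ²`, so that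
`|∂ₜ²φ - t ∂ₓ²φ| ≤ 3 C ε⁴ φ^(1/p)`, and the right side is supported in a box of area `8 ε⁻⁵`. In the
weak equation, Young's inequality absorbs the term that contains `u` into `∬ |u|^p φ`, and with
`q = p / (p - 1)` there remains `∫ u₁ ≤ const · ε^(4 q - 5)` (`integral_initial_velocity_le`).
For `p < 5` the exponent is positive, and `ε → 0` contradicts `∫ u₁ > 0`.

The absorption needs absolutely convergent integrals. They come from the embedding of `H¹(ℝ)` into
the continuous functions: `contRep w x` depends continuously on `(w, x)` jointly
(`continuous_contRep_uncurry`) and agrees with `w` almost everywhere (`contRep_ae_eq`), so a weak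
solution is represented by one continuous function of `(t, x)` on the closed half plane. -/

/-! ### The continuous representative of an element of `H¹(ℝ)` -/

theorem locallyIntegrable_L2R (f : L2R) : LocallyIntegrable f volume :=
  (Lp.memLp f).locallyIntegrable (by norm_num)

theorem intervalIntegrable_of_locallyIntegrable {f : ℝ → ℝ} (hf : LocallyIntegrable f volume)
    (a b : ℝ) : IntervalIntegrable f volume a b :=
  (hf.integrableOn_isCompact isCompact_uIcc).intervalIntegrable

/-- Fubini's theorem applies to `∬ c(z) f(y) ψ(y - z) dz dy` over `z ∈ (0, 1]`. -/
theorem integrable_mul_translate {f c ψ : ℝ → ℝ} (hf : LocallyIntegrable f volume)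
    (hc : Continuous c) (hψ : Continuous ψ) (hψc : HasCompactSupport ψ) :
    Integrable (fun w : ℝ × ℝ => f w.1 * (c w.2 * ψ (w.1 - w.2)))
      ((volume : Measure ℝ).prod (volume.restrict (Ioc (0 : ℝ) 1))) := by
  obtain ⟨R, hR⟩ := hψc.isCompact.isBounded.subset_closedBall 0
  have hψ0 : ∀ x, ψ x ≠ 0 → |x| ≤ R := fun x hx => by
    simpa using hR (subset_tsupport _ hx)
  obtain ⟨M, hM⟩ := hψ.bounded_above_of_compact_support hψc
  obtain ⟨N, hN⟩ := (isCompact_Icc (a := (0 : ℝ)) (b := 1)).exists_bound_of_continuousOn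
    hc.continuousOn
  have hmem : ∀ᵐ w ∂((volume : Measure ℝ).prod (volume.restrict (Ioc (0 : ℝ) 1))),
      w.2 ∈ Ioc (0 : ℝ) 1 :=
    Measure.quasiMeasurePreserving_snd.ae (ae_restrict_mem measurableSet_Ioc)
  have h1 : Integrable ((Icc (-R) (R + 1)).indicator f) volume :=
    (hf.integrableOn_isCompact isCompact_Icc).integrable_indicator measurableSet_Icc
  have h2 := h1.mul_prod (integrable_const (μ := volume.restrict (Ioc (0 : ℝ) 1)) (1 : ℝ))
  have hcont : Continuous fun w : ℝ × ℝ => c w.2 * ψ (w.1 - w.2) := by fun_prop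
  have h3 := h2.mul_bdd (c := N * M) hcont.aestronglyMeasurable (by
    filter_upwards [hmem] with w hw
    rw [norm_mul]
    have hNw := hN w.2 (Ioc_subset_Icc_self hw)
    exact mul_le_mul hNw (hM _) (norm_nonneg _) ((norm_nonneg _).trans hNw))
  refine h3.congr ?_
  filter_upwards [hmem] with w hw
  by_cases h : w.1 ∈ Icc (-R) (R + 1)
  · simp [indicator_of_mem h]
  · have : ψ (w.1 - w.2) = 0 := by
      by_contra hne
      have := abs_le.1 (hψ0 _ hne)
      exact h ⟨by linarith [hw.1], by linarith [hw.2]⟩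
    simp [this]

theorem integrable_mul_integral_translate {f c ψ : ℝ → ℝ} (hf : LocallyIntegrable f volume)
    (hc : Continuous c) (hψ : Continuous ψ) (hψc : HasCompactSupport ψ) :
    Integrable fun y => f y * ∫ z in (0 : ℝ)..1, c z * ψ (y - z) := by
  refine (integrable_mul_translate hf hc hψ hψc).integral_prod_left.congr
    (Filter.Eventually.of_forall fun y => ?_)
  simp only [intervalIntegral.integral_of_le zero_le_one]
  exact integral_const_mul _ _

theorem integral_mul_integral_translate {f c ψ : ℝ → ℝ} (hf : LocallyIntegrable f volume)
    (hc : Continuous c) (hψ : Continuous ψ) (hψc : HasCompactSupport ψ) :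
    ∫ y, f y * (∫ z in (0 : ℝ)..1, c z * ψ (y - z))
      = ∫ z in (0 : ℝ)..1, c z * ∫ y, f y * ψ (y - z) := by
  simp_rw [intervalIntegral.integral_of_le zero_le_one, ← integral_const_mul]
  rw [integral_integral_swap (integrable_mul_translate hf hc hψ hψc)]
  congr 1; ext z; congr 1; ext y; ring

theorem integral_translate_mul {f c ψ : ℝ → ℝ} (hf : LocallyIntegrable f volume)
    (hc : Continuous c) (hψ : Continuous ψ) (hψc : HasCompactSupport ψ) :
    ∫ x, (∫ z in (0 : ℝ)..1, c z * f (x + z)) * ψ x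
      = ∫ z in (0 : ℝ)..1, c z * ∫ y, f y * ψ (y - z) := by
  have h := (measurePreserving_add_prod (volume : Measure ℝ)
    (volume.restrict (Ioc (0 : ℝ) 1))).integrable_comp_of_integrable
      (integrable_mul_translate hf hc hψ hψc)
  have h' : Integrable (Function.uncurry fun x z : ℝ => c z * f (x + z) * ψ x)
      ((volume : Measure ℝ).prod (volume.restrict (Ioc (0 : ℝ) 1))) := by
    refine h.congr (Filter.Eventually.of_forall fun w => ?_)
    simp only [Function.comp, Function.uncurry, add_sub_cancel_right]
    ring
  simp_rw [intervalIntegral.integral_of_le zero_le_one, ← integral_mul_const]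
  rw [integral_integral_swap h']
  congr 1; ext z
  rw [← integral_const_mul, ← integral_add_right_eq_self (fun y => c z * (f y * ψ (y - z))) z]
  congr 1; ext x
  rw [add_sub_cancel_right]; ring

/-- The continuous representative of `(f, f') ∈ H¹(ℝ)`, obtained by integrating
`((x + 1 - y) f(y))' = (x + 1 - y) f'(y) - f(y)` over `y ∈ [x, x + 1]`. -/
noncomputable def contRep (w : H1R) (x : ℝ) : ℝ :=
  (∫ y in x..x + 1, toL2 w y)
    - ∫ y in x..x + 1, (x + 1 - y) * (w : WithLp 2 (L2R × L2R)).snd y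

theorem locallyIntegrable_continuous_mul {f c : ℝ → ℝ} (hf : LocallyIntegrable f volume)
    (hc : Continuous c) : LocallyIntegrable (fun y => c y * f y) volume := by
  rw [← locallyIntegrableOn_univ] at hf ⊢
  exact hf.continuousOn_mul hc.continuousOn isOpen_univ.isLocallyClosed

theorem continuous_integral_unit {f : ℝ → ℝ} (hf : LocallyIntegrable f volume) :
    Continuous fun x : ℝ => ∫ y in x..x + 1, f y := by
  have hi : ∀ a b : ℝ, IntervalIntegrable f volume a b := intervalIntegrable_of_locallyIntegrable hf
  have hF := intervalIntegral.continuous_primitive hi 0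
  have : (fun x : ℝ => ∫ y in x..x + 1, f y)
      = fun x => (∫ y in (0 : ℝ)..x + 1, f y) - ∫ y in (0 : ℝ)..x, f y := by
    ext x
    rw [intervalIntegral.integral_interval_sub_left (hi _ _) (hi _ _)]
  rw [this]
  exact (hF.comp (continuous_id.add continuous_const)).sub hF

theorem continuous_integral_unit_weighted {g : ℝ → ℝ} (hg : LocallyIntegrable g volume) :
    Continuous fun x : ℝ => ∫ y in x..x + 1, (x + 1 - y) * g y := by
  have hyg := locallyIntegrable_continuous_mul hg continuous_id
  have : (fun x : ℝ => ∫ y in x..x + 1, (x + 1 - y) * g y)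
      = fun x => (x + 1) * (∫ y in x..x + 1, g y) - ∫ y in x..x + 1, id y * g y := by
    ext x
    rw [← intervalIntegral.integral_const_mul, ← intervalIntegral.integral_sub
      ((intervalIntegrable_of_locallyIntegrable hg _ _).const_mul _)
      (intervalIntegrable_of_locallyIntegrable hyg _ _)]
    congr 1; ext y; simp only [id]; ring
  rw [this]
  exact ((continuous_id.add continuous_const).mul (continuous_integral_unit hg)).sub
    (continuous_integral_unit hyg)

theorem continuous_contRep (w : H1R) : Continuous (contRep w) :=
  (continuous_integral_unit (locallyIntegrable_L2R _)).sub
    (continuous_integral_unit_weighted (locallyIntegrable_L2R _))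

theorem integral_unit_abs_le (f : L2R) (x : ℝ) : ∫ y in x..x + 1, |f y| ≤ ‖f‖ := by
  have hv : volume (Ioc x (x + 1)) = 1 := by simp
  rw [intervalIntegral.integral_of_le (by linarith)]
  have h1 : ∫ y in Ioc x (x + 1), |f y| = ∫ y in Ioc x (x + 1), (|f| : L2R) y :=
    setIntegral_congr_ae measurableSet_Ioc ((Lp.coeFn_abs f).mono fun y hy _ => hy.symm)
  rw [h1, ← L2.inner_indicatorConstLp_one (𝕜 := ℝ) measurableSet_Ioc (by simp [hv])]
  refine (real_inner_le_norm _ _).trans ?_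
  rw [norm_indicatorConstLp (by norm_num) (by norm_num), norm_abs_eq_norm]
  simp [Measure.real, hv]

theorem abs_contRep_le (w : H1R) (x : ℝ) : |contRep w x| ≤ 2 * ‖w‖ := by
  set g := (w : WithLp 2 (L2R × L2R)).snd with hg
  have hi : ∀ h : L2R, IntervalIntegrable (fun y => |h y|) volume x (x + 1) := fun h =>
    (intervalIntegrable_of_locallyIntegrable (locallyIntegrable_L2R h) _ _).abs
  have h1 : |∫ y in x..x + 1, toL2 w y| ≤ ‖w‖ :=
    (intervalIntegral.abs_integral_le_integral_abs (by linarith)).trans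
      ((integral_unit_abs_le _ _).trans (WithLp.norm_fst_le _ _))
  have h2 : |∫ y in x..x + 1, (x + 1 - y) * g y| ≤ ‖w‖ := by
    refine le_trans ?_ ((integral_unit_abs_le g x).trans (WithLp.norm_snd_le _ _))
    rw [← Real.norm_eq_abs]
    refine intervalIntegral.norm_integral_le_of_norm_le (by linarith) ?_ (hi g)
    refine Filter.Eventually.of_forall fun y hy => ?_
    rw [norm_mul, Real.norm_eq_abs, Real.norm_eq_abs]
    refine mul_le_of_le_one_left (abs_nonneg _) ?_
    rw [abs_le]; constructor <;> linarith [hy.1, hy.2]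
  exact (abs_sub _ _).trans (by linarith)

theorem contRep_sub (v w : H1R) (x : ℝ) : contRep (v - w) x = contRep v x - contRep w x := by
  have key : ∀ (f g : L2R) (c : ℝ → ℝ), Continuous c →
      ∫ y in x..x + 1, c y * (f - g : L2R) y
        = (∫ y in x..x + 1, c y * f y) - ∫ y in x..x + 1, c y * g y := by
    intro f g c hc
    rw [← intervalIntegral.integral_sub
      (intervalIntegrable_of_locallyIntegrable
        (locallyIntegrable_continuous_mul (locallyIntegrable_L2R f) hc) _ _)
      (intervalIntegrable_of_locallyIntegrable
        (locallyIntegrable_continuous_mul (locallyIntegrable_L2R g) hc) _ _)]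
    refine intervalIntegral.integral_congr_ae ((Lp.coeFn_sub f g).mono fun y hy _ => ?_)
    rw [hy, Pi.sub_apply, mul_sub]
  have h1 := key (toL2 v) (toL2 w) (fun _ => 1) continuous_const
  have h2 := key (v : WithLp 2 (L2R × L2R)).snd (w : WithLp 2 (L2R × L2R)).snd
    (fun y => x + 1 - y) (by fun_prop)
  simp only [one_mul] at h1
  have e1 : toL2 (v - w) = toL2 v - toL2 w := rfl
  have e2 : ((v - w : H1R) : WithLp 2 (L2R × L2R)).snd
    = (v : WithLp 2 (L2R × L2R)).snd - (w : WithLp 2 (L2R × L2R)).snd := rfl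
  unfold contRep
  rw [e1, e2, h1, h2]
  ring

theorem continuous_contRep_uncurry : Continuous fun q : H1R × ℝ => contRep q.1 q.2 := by
  refine continuous_prod_of_continuous_lipschitzWith _ 2 continuous_contRep fun x => ?_
  refine LipschitzWith.of_dist_le_mul fun v w => ?_
  rw [Real.dist_eq, dist_eq_norm, ← contRep_sub]
  exact abs_contRep_le _ _

/-- A test function is recovered from itself and its derivative by the adjoint of the averaging
formula that defines `contRep`. -/
theorem integral_translate_add_deriv {ψ : ℝ → ℝ} (hψ : ContDiff ℝ ∞ ψ) (y : ℝ) :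
    (∫ z in (0 : ℝ)..1, 1 * ψ (y - z)) + (∫ z in (0 : ℝ)..1, (1 - z) * deriv ψ (y - z)) = ψ y := by
  have hd : Continuous (deriv ψ) := hψ.continuous_deriv (by simp)
  have hψ0 := hψ.continuous
  have hdd : Differentiable ℝ ψ := hψ.differentiable (by simp)
  rw [← intervalIntegral.integral_add
    (Continuous.intervalIntegrable (by fun_prop) _ _)
    (Continuous.intervalIntegrable (by fun_prop) _ _)]
  rw [intervalIntegral.integral_eq_sub_of_hasDerivAt (f := fun z => -((1 - z) * ψ (y - z)))
    (fun z _ => ?_) (Continuous.intervalIntegrable (by fun_prop) _ _)]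
  · simp
  · have h1 : HasDerivAt (fun z => ψ (y - z)) (-deriv ψ (y - z)) z := by
      simpa using (hdd (y - z)).hasDerivAt.comp_const_sub y z
    refine (((hasDerivAt_id z).const_sub 1).mul h1).neg.congr_deriv ?_
    simp only [id]; ring

theorem contRep_eq_translate (w : H1R) (x : ℝ) :
    contRep w x = (∫ z in (0 : ℝ)..1, 1 * toL2 w (x + z))
      - ∫ z in (0 : ℝ)..1, (1 - z) * (w : WithLp 2 (L2R × L2R)).snd (x + z) := by
  have h1 := intervalIntegral.integral_comp_add_left (a := 0) (b := 1) (fun y => toL2 w y) x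
  have h2 := intervalIntegral.integral_comp_add_left (a := 0) (b := 1)
    (fun y => (x + 1 - y) * (w : WithLp 2 (L2R × L2R)).snd y) x
  simp only [add_zero] at h1 h2
  unfold contRep
  rw [← h1, ← h2]
  congr 1
  · simp
  · congr 1; ext z; ring

theorem contRep_ae_eq (w : H1R) : ∀ᵐ x, toL2 w x = contRep w x := by
  refine ae_eq_of_integral_contDiff_smul_eq (locallyIntegrable_L2R _)
    (continuous_contRep w).locallyIntegrable fun ψ hψ hc => ?_
  set f := toL2 w with hf
  set g := (w : WithLp 2 (L2R × L2R)).snd with hg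
  have hlf : LocallyIntegrable f volume := locallyIntegrable_L2R _
  have hlg : LocallyIntegrable g volume := locallyIntegrable_L2R _
  have hd : Continuous (deriv ψ) := hψ.continuous_deriv (by simp)
  have hψ0 := hψ.continuous
  have hc1 : Continuous fun _ : ℝ => (1 : ℝ) := continuous_const
  have hc2 : Continuous fun z : ℝ => 1 - z := by fun_prop
  have hweak : ∀ z : ℝ, ∫ y, g y * ψ (y - z) = -∫ y, f y * deriv ψ (y - z) := by
    intro z
    have hz := w.2 (fun y => ψ (y - z)) (by fun_prop) (by
      exact hc.comp_homeomorph (Homeomorph.subRight z))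
    simp only [deriv_comp_sub_const] at hz
    rw [show (∫ y, f y * deriv ψ (y - z)) = _ from hz, neg_neg]
  have hA1 : Continuous fun x : ℝ => ∫ z in (0 : ℝ)..1, 1 * f (x + z) := by
    convert continuous_integral_unit hlf using 2 with x
    simp
  have hA2 : Continuous fun x : ℝ => ∫ z in (0 : ℝ)..1, (1 - z) * g (x + z) := by
    convert hA1.sub (continuous_contRep w) using 2 with x
    rw [Pi.sub_apply, contRep_eq_translate]; ring
  have hlhs : ∫ x, ψ x • f x = (∫ y, f y * ∫ z in (0 : ℝ)..1, 1 * ψ (y - z))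
      + ∫ y, f y * ∫ z in (0 : ℝ)..1, (1 - z) * deriv ψ (y - z) := by
    rw [← integral_add (integrable_mul_integral_translate hlf hc1 hψ0 hc)
      (integrable_mul_integral_translate hlf hc2 hd hc.deriv)]
    congr 1; ext y
    rw [← mul_add, integral_translate_add_deriv hψ, smul_eq_mul, mul_comm]
  have hrhs : ∫ x, ψ x • contRep w x = (∫ x, (∫ z in (0 : ℝ)..1, 1 * f (x + z)) * ψ x)
      - ∫ x, (∫ z in (0 : ℝ)..1, (1 - z) * g (x + z)) * ψ x := by
    have i1 : Integrable fun x => (∫ z in (0 : ℝ)..1, 1 * f (x + z)) * ψ x :=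
      (hA1.mul hψ0).integrable_of_hasCompactSupport hc.mul_left
    have i2 : Integrable fun x => (∫ z in (0 : ℝ)..1, (1 - z) * g (x + z)) * ψ x :=
      (hA2.mul hψ0).integrable_of_hasCompactSupport hc.mul_left
    rw [← integral_sub i1 i2]
    congr 1; ext x
    rw [contRep_eq_translate, smul_eq_mul]; ring
  rw [hlhs, hrhs, integral_mul_integral_translate hlf hc1 hψ0 hc,
    integral_mul_integral_translate hlf hc2 hd hc.deriv, integral_translate_mul hlf hc1 hψ0 hc,
    integral_translate_mul hlg hc2 hψ0 hc]
  simp_rw [hweak, mul_neg]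
  rw [intervalIntegral.integral_neg, sub_neg_eq_add]

/-! ### A cutoff whose second derivative is controlled by a power of itself -/

theorem exists_bound_deriv_of_compact {η : ℝ → ℝ} (hη : ContDiff ℝ ∞ η)
    (hc : HasCompactSupport η) :
    ∃ M, 0 ≤ M ∧ ∀ s, |deriv η s| ≤ M ∧ |deriv (deriv η) s| ≤ M := by
  have h1 : ContDiff ℝ ∞ (deriv η) := hη.deriv'
  obtain ⟨M₁, h₁⟩ := h1.continuous.bounded_above_of_compact_support hc.deriv
  have h2 : ContDiff ℝ ∞ (deriv (deriv η)) := h1.deriv'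
  obtain ⟨M₂, h₂⟩ := h2.continuous.bounded_above_of_compact_support hc.deriv.deriv
  exact ⟨max M₁ M₂, ((norm_nonneg _).trans (h₁ 0)).trans (le_max_left _ _), fun s =>
    ⟨(h₁ s).trans (le_max_left _ _), (h₂ s).trans (le_max_right _ _)⟩⟩

/-- The cutoff is a high power of a bump function: two derivatives lower the exponent `k` to
`k - 2`, which is still at least `k / p` as soon as `k (p - 1) ≥ 2 p`. -/
theorem exists_cutoff {p : ℝ} (hp : 1 < p) :
    ∃ χ : ℝ → ℝ, ContDiff ℝ ∞ χ ∧ (∀ s, 0 ≤ χ s) ∧ (∀ s, χ s ≤ 1) ∧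
      (∀ s, |s| ≤ 1 → χ s = 1) ∧ (∀ s, 2 ≤ |s| → χ s = 0) ∧
      ∃ C, 0 ≤ C ∧ ∀ s, |iteratedDeriv 2 χ s| ≤ C * χ s ^ (1 / p) := by
  let b : ContDiffBump (0 : ℝ) := ⟨1, 2, by norm_num, by norm_num⟩
  have hη : ContDiff ℝ ∞ b := b.contDiff
  obtain ⟨M, hM0, hM⟩ := exists_bound_deriv_of_compact hη b.hasCompactSupport
  obtain ⟨n, hn⟩ := exists_nat_ge (2 / (p - 1))
  have hp1 : 0 < p - 1 := by linarith
  have hp0 : 0 < p := by linarith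
  have hn' : ((n + 2 : ℕ) : ℝ) * (1 / p) ≤ n := by
    rw [div_le_iff₀ hp1] at hn
    push_cast
    rw [mul_one_div, div_le_iff₀ hp0]
    linarith
  have hdη : Differentiable ℝ b := hη.differentiable (by simp)
  have hd2 : Differentiable ℝ (deriv b) :=
    ContDiff.differentiable (n := ∞) hη.deriv' (by simp)
  refine ⟨fun s => b s ^ (n + 2), hη.pow _, fun s => pow_nonneg b.nonneg _,
    fun s => pow_le_one₀ b.nonneg b.le_one, fun s hs => ?_, fun s hs => ?_,
    (n + 2) * (n + 1) * M ^ 2 + (n + 2) * M, by positivity, fun s => ?_⟩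
  · beta_reduce
    rw [b.one_of_mem_closedBall (by simpa using hs), one_pow]
  · beta_reduce
    rw [b.zero_of_le_dist (by simpa using hs), zero_pow (by omega)]
  · have e1 : deriv (fun s => b s ^ (n + 2)) = fun s => (n + 2) * b s ^ (n + 1) * deriv b s := by
      ext s
      refine ((hdη s).hasDerivAt.pow (n + 2)).deriv.trans ?_
      push_cast; rfl
    have e2 : iteratedDeriv 2 (fun s => b s ^ (n + 2)) s
        = (n + 2) * (n + 1) * b s ^ n * deriv b s ^ 2
          + (n + 2) * b s ^ (n + 1) * deriv (deriv b) s := by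
      rw [iteratedDeriv_succ, iteratedDeriv_one, e1]
      have h := ((((hdη s).hasDerivAt.pow (n + 1)).const_mul ((n : ℝ) + 2)).mul
        (hd2 s).hasDerivAt).deriv
      refine Eq.trans ?_ (h.trans ?_)
      · rfl
      · simp only [Nat.add_sub_cancel, Pi.pow_apply]; push_cast; ring
    have hb0 : 0 ≤ b s := b.nonneg
    have hb1 : b s ≤ 1 := b.le_one
    have hle : b s ^ n ≤ (b s ^ (n + 2)) ^ (1 / p) := by
      rw [← Real.rpow_natCast, ← Real.rpow_natCast, ← Real.rpow_mul hb0]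
      exact Real.rpow_le_rpow_of_exponent_ge_of_imp hb0 hb1 hn' (by
        intro _ h0
        exact absurd h0 (lt_of_lt_of_le (by positivity) hn').ne')
    obtain ⟨hs1, hs2⟩ := hM s
    have hpow : b s ^ (n + 1) ≤ b s ^ n := pow_le_pow_of_le_one hb0 hb1 (by omega)
    have hn0 : 0 ≤ b s ^ n := pow_nonneg hb0 _
    have hsq : deriv b s ^ 2 ≤ M ^ 2 := sq_le_sq' (abs_le.1 hs1).1 (abs_le.1 hs1).2
    rw [e2]
    calc _ ≤ |(n + 2) * (n + 1) * b s ^ n * deriv b s ^ 2|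
          + |(n + 2) * b s ^ (n + 1) * deriv (deriv b) s| := abs_add_le _ _
      _ = (n + 2) * (n + 1) * b s ^ n * deriv b s ^ 2
          + (n + 2) * b s ^ (n + 1) * |deriv (deriv b) s| := by
        rw [abs_of_nonneg (by positivity), abs_mul, abs_of_nonneg (by positivity)]
      _ ≤ (n + 2) * (n + 1) * b s ^ n * M ^ 2 + (n + 2) * b s ^ n * M := by
        gcongr
      _ = ((n + 2) * (n + 1) * M ^ 2 + (n + 2) * M) * b s ^ n := by ring
      _ ≤ _ := by gcongr

/-! ### The test function estimate -/

/-- The wave operator `∂ₜ² - t ∂ₓ²` applied to `χ(a t) χ(b x)`. -/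
noncomputable def tricomiCutoff (χ : ℝ → ℝ) (a b : ℝ) (w : ℝ × ℝ) : ℝ :=
  a ^ 2 * iteratedDeriv 2 χ (a * w.1) * χ (b * w.2)
    - w.1 * (b ^ 2 * χ (a * w.1) * iteratedDeriv 2 χ (b * w.2))

theorem tricomiCutoff_eq {χ : ℝ → ℝ} (hχ : ContDiff ℝ ∞ χ) (a b t x : ℝ) :
    iteratedDeriv 2 (fun s => χ (a * s) * χ (b * x)) t
        - t * iteratedDeriv 2 (fun y => χ (a * t) * χ (b * y)) x
      = tricomiCutoff χ a b (t, x) := by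
  have h2 : ContDiff ℝ 2 χ := contDiff_infty.1 hχ 2
  have key : ∀ c y : ℝ, iteratedDeriv 2 (fun s => χ (c * s)) y
      = c ^ 2 * iteratedDeriv 2 χ (c * y) := fun c y => by
    rw [iteratedDeriv_comp_const_mul h2]
  simp only [mul_comm (χ (a * _)) (χ (b * x))]
  rw [iteratedDeriv_const_mul_field, iteratedDeriv_const_mul_field, key, key]
  simp only [tricomiCutoff]
  ring

/-- Under the scaling `b² = a³` the two terms of the operator have the same order `a²`. -/
theorem abs_tricomiCutoff_le {p C a b : ℝ} (hp : 1 < p) {χ : ℝ → ℝ} (hχ0 : ∀ s, 0 ≤ χ s)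
    (hχ1 : ∀ s, χ s ≤ 1) (hχ2 : ∀ s, 2 ≤ |s| → χ s = 0) (hC : 0 ≤ C)
    (hχC : ∀ s, |iteratedDeriv 2 χ s| ≤ C * χ s ^ (1 / p)) (ha : 0 < a) (hab : b ^ 2 = a ^ 3)
    {w : ℝ × ℝ} (hw : 0 ≤ w.1) :
    |tricomiCutoff χ a b w| ≤ 3 * C * a ^ 2 * (χ (a * w.1) * χ (b * w.2)) ^ (1 / p) := by
  have hle : ∀ s, χ s ≤ χ s ^ (1 / p) := fun s => by
    refine Real.self_le_rpow_of_le_one (hχ0 s) (hχ1 s) ?_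
    rw [div_le_one (by linarith)]; exact hp.le
  have h0 : ∀ s, 0 ≤ χ s ^ (1 / p) := fun s => Real.rpow_nonneg (hχ0 s) _
  have hat : a * w.1 * χ (a * w.1) ≤ 2 * χ (a * w.1) ^ (1 / p) := by
    by_cases h : 2 ≤ |a * w.1|
    · rw [hχ2 _ h, mul_zero]
      exact mul_nonneg zero_le_two (Real.rpow_nonneg le_rfl _)
    · exact mul_le_mul ((le_abs_self _).trans (not_le.1 h).le) (hle _) (hχ0 _) zero_le_two
  have hat0 : 0 ≤ a * w.1 * χ (a * w.1) := mul_nonneg (by positivity) (hχ0 _)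
  have e : tricomiCutoff χ a b w = a ^ 2 * (iteratedDeriv 2 χ (a * w.1) * χ (b * w.2)
      - a * w.1 * χ (a * w.1) * iteratedDeriv 2 χ (b * w.2)) := by
    simp only [tricomiCutoff]
    linear_combination (-w.1 * χ (a * w.1) * iteratedDeriv 2 χ (b * w.2)) * hab
  rw [e, abs_mul, abs_of_nonneg (by positivity : 0 ≤ a ^ 2), Real.mul_rpow (hχ0 _) (hχ0 _)]
  have h1 : |iteratedDeriv 2 χ (a * w.1) * χ (b * w.2)|
      ≤ C * χ (a * w.1) ^ (1 / p) * χ (b * w.2) ^ (1 / p) := by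
    rw [abs_mul, abs_of_nonneg (hχ0 (b * w.2))]
    exact mul_le_mul (hχC _) (hle _) (hχ0 _) (mul_nonneg hC (h0 _))
  have h2 : |a * w.1 * χ (a * w.1) * iteratedDeriv 2 χ (b * w.2)|
      ≤ 2 * χ (a * w.1) ^ (1 / p) * (C * χ (b * w.2) ^ (1 / p)) := by
    rw [abs_mul, abs_of_nonneg hat0]
    exact mul_le_mul hat (hχC _) (abs_nonneg _) (mul_nonneg zero_le_two (h0 _))
  calc _ ≤ a ^ 2 * (C * χ (a * w.1) ^ (1 / p) * χ (b * w.2) ^ (1 / p)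
        + 2 * χ (a * w.1) ^ (1 / p) * (C * χ (b * w.2) ^ (1 / p))) := by
        gcongr
        exact (abs_sub _ _).trans (add_le_add h1 h2)
    _ = _ := by ring

/-- A weak solution as a continuous function of `(t, x)`, extended constantly to `t < 0`. -/
noncomputable def spaceTimeRep (u : ℝ → H1R) (w : ℝ × ℝ) : ℝ := contRep (u (max w.1 0)) w.2

theorem continuous_spaceTimeRep {u : ℝ → H1R} (hu : ContinuousOn u (Ici 0)) :
    Continuous (spaceTimeRep u) := by
  have h : Continuous fun t : ℝ => u (max t 0) :=
    hu.comp_continuous (by fun_prop) fun t => le_max_right t 0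
  exact continuous_contRep_uncurry.comp ((h.comp continuous_fst).prodMk continuous_snd)

theorem ae_eq_spaceTimeRep (u : ℝ → H1R) {t : ℝ} (ht : 0 ≤ t) :
    ∀ᵐ x, toL2 (u t) x = spaceTimeRep u (t, x) := by
  simpa only [spaceTimeRep, max_eq_left ht] using contRep_ae_eq (u t)

theorem integrable_halfPlane {F : ℝ × ℝ → ℝ} (hF : Continuous F) (hc : HasCompactSupport F) :
    Integrable F ((volume.restrict (Ioi (0 : ℝ))).prod volume) := by
  have h := (hF.integrable_of_hasCompactSupport (μ := (volume : Measure ℝ).prod volume) hc)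
  rw [← Measure.restrict_univ (μ := (volume : Measure ℝ)), Measure.restrict_restrict (by simp),
    Measure.prod_restrict, inter_univ]
  exact h.restrict

theorem hasCompactSupport_of_box {A B : ℝ} {F : ℝ × ℝ → ℝ}
    (h : ∀ w : ℝ × ℝ, (A ≤ |w.1| ∨ B ≤ |w.2|) → F w = 0) : HasCompactSupport F := by
  refine HasCompactSupport.intro (isCompact_Icc.prod isCompact_Icc :
    IsCompact (Icc (-A) A ×ˢ Icc (-B) B)) fun w hw => h w ?_
  by_contra! hcon
  exact hw ⟨abs_le.1 hcon.1.le, abs_le.1 hcon.2.le⟩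

/-- The heart of the test function method. Tested with `φ(t, x) = χ(a t) χ(b x)`, the weak equation
reads `∬ |u|^p φ + ∫ u₁ = ∬ u (∂ₜ²φ - t ∂ₓ²φ)`, since `φ(0, ·) = 1` on the support of `u₁` and
`∂ₜφ(0, ·) = 0`. Young's inequality bounds the right side by `(1 / p) ∬ |u|^p φ` plus the constant
`(3 C a²)^q / q` times the area `8 / (a b)` of a box that contains the support of `φ` in `t > 0`. -/
theorem integral_initial_velocity_le {p q C a b : ℝ} (hpq : p.HolderConjugate q) {χ : ℝ → ℝ}
    (hχ : ContDiff ℝ ∞ χ) (hχ0 : ∀ s, 0 ≤ χ s) (hχ1 : ∀ s, χ s ≤ 1)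
    (hχ11 : ∀ s, |s| ≤ 1 → χ s = 1) (hχ2 : ∀ s, 2 ≤ |s| → χ s = 0) (hC : 0 ≤ C)
    (hχC : ∀ s, |iteratedDeriv 2 χ s| ≤ C * χ s ^ (1 / p)) (ha : 0 < a) (hb : 0 < b)
    (hab : b ^ 2 = a ^ 3) {u₀ u₁ : ℝ → ℝ} {u : ℝ → H1R} (hu : IsGlobalWeakSolution p u₀ u₁ u)
    (hsupp : ∀ x, u₁ x ≠ 0 → |b * x| ≤ 1) :
    ∫ x, u₁ x ≤ (3 * C * a ^ 2) ^ q / q * (8 / (a * b)) := by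
  have hp : 1 < p := hpq.lt
  have hp0 : 0 < p := hpq.pos
  have hq0 : 0 < q := hpq.symm.pos
  set μ : Measure (ℝ × ℝ) := (volume.restrict (Ioi (0 : ℝ))).prod volume with hμ
  set U := spaceTimeRep u with hU
  have hUc : Continuous U := continuous_spaceTimeRep hu.continuous_H1
  set φ : ℝ × ℝ → ℝ := fun w => χ (a * w.1) * χ (b * w.2) with hφ
  have hφ0 : ∀ w, 0 ≤ φ w := fun w => mul_nonneg (hχ0 _) (hχ0 _)
  have hφs : ContDiff ℝ ∞ φ :=
    (hχ.comp (contDiff_const.mul contDiff_fst)).mul (hχ.comp (contDiff_const.mul contDiff_snd))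
  have hzero : ∀ w : ℝ × ℝ, (2 / a ≤ |w.1| ∨ 2 / b ≤ |w.2|) → φ w = 0 := by
    rintro w (h | h)
    · have : χ (a * w.1) = 0 := hχ2 _ (by
        rw [abs_mul, abs_of_pos ha]; rwa [div_le_iff₀' ha] at h)
      simp [hφ, this]
    · have : χ (b * w.2) = 0 := hχ2 _ (by
        rw [abs_mul, abs_of_pos hb]; rwa [div_le_iff₀' hb] at h)
      simp [hφ, this]
  have hφc : HasCompactSupport φ := hasCompactSupport_of_box hzero
  have hLzero : ∀ w : ℝ × ℝ, (2 / a ≤ |w.1| ∨ 2 / b ≤ |w.2|) → tricomiCutoff χ a b w = 0 := by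
    have h0 : ∀ s, 2 ≤ |s| → iteratedDeriv 2 χ s = 0 := fun s hs => by
      have := hχC s
      rw [hχ2 s hs, Real.zero_rpow (by positivity), mul_zero] at this
      exact abs_nonpos_iff.1 this
    rintro w (h | h)
    · have hs : 2 ≤ |a * w.1| := by
        rw [abs_mul, abs_of_pos ha]; rwa [div_le_iff₀' ha] at h
      simp [tricomiCutoff, hχ2 _ hs, h0 _ hs]
    · have hs : 2 ≤ |b * w.2| := by
        rw [abs_mul, abs_of_pos hb]; rwa [div_le_iff₀' hb] at h
      simp [tricomiCutoff, hχ2 _ hs, h0 _ hs]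
  have hχ'' : Continuous (iteratedDeriv 2 χ) :=
    (contDiff_infty.1 hχ 2).continuous_iteratedDeriv 2 le_rfl
  have hχc := hχ.continuous
  have hLc : Continuous (tricomiCutoff χ a b) := by unfold tricomiCutoff; fun_prop
  have iL : Integrable (fun w => U w * tricomiCutoff χ a b w) μ :=
    integrable_halfPlane (hUc.mul hLc) (hasCompactSupport_of_box hLzero).mul_left
  have iN : Integrable (fun w => |U w| ^ p * φ w) μ :=
    integrable_halfPlane ((hUc.abs.rpow_const fun _ => Or.inr hp0.le).mul hφs.continuous)
      hφc.mul_left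
  have hweak := hu.weak_eq φ hφs hφc
  have e1 : ∫ t in Ioi (0 : ℝ), ∫ x, toL2 (u t) x *
      (iteratedDeriv 2 (fun s => φ (s, x)) t - t * iteratedDeriv 2 (fun y => φ (t, y)) x)
      = ∫ w, U w * tricomiCutoff χ a b w ∂μ := by
    rw [integral_prod _ iL]
    refine setIntegral_congr_fun measurableSet_Ioi fun t ht => integral_congr_ae ?_
    filter_upwards [ae_eq_spaceTimeRep u (le_of_lt ht)] with x hx
    rw [hx, ← tricomiCutoff_eq hχ]
  have e2 : ∫ t in Ioi (0 : ℝ), ∫ x, |toL2 (u t) x| ^ p * φ (t, x)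
      = ∫ w, |U w| ^ p * φ w ∂μ := by
    rw [integral_prod _ iN]
    refine setIntegral_congr_fun measurableSet_Ioi fun t ht => integral_congr_ae ?_
    filter_upwards [ae_eq_spaceTimeRep u (le_of_lt ht)] with x hx
    rw [hx]
  have e3 : ∫ x, u₁ x * φ (0, x) = ∫ x, u₁ x := by
    congr 1; ext x
    by_cases hx : u₁ x = 0
    · simp [hx]
    · simp [hφ, hχ11 0 (by simp), hχ11 _ (hsupp x hx)]
  -- `φ` does not depend on `t` near `t = 0`, so `u₀` drops out of the identity.
  have e4 : ∀ x, deriv (fun s => φ (s, x)) 0 = 0 := by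
    intro x
    have hev : (fun s => φ (s, x)) =ᶠ[nhds 0] fun _ => χ (b * x) := by
      have hcont : Filter.Tendsto (fun s : ℝ => |a * s|) (nhds 0) (nhds 0) := by
        have : Continuous fun s : ℝ => |a * s| := by fun_prop
        simpa using this.tendsto 0
      filter_upwards [hcont.eventually (gt_mem_nhds one_pos)] with s hs
      simp [hφ, hχ11 _ hs.le]
    rw [hev.deriv_eq, deriv_const]
  simp only [e4, mul_zero, integral_zero, sub_zero] at hweak
  rw [e1, e2, e3] at hweak
  -- The box that contains the support of the test function in the half plane.
  set S : Set (ℝ × ℝ) := Ioc 0 (2 / a) ×ˢ Icc (-(2 / b)) (2 / b) with hS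
  have hSm : MeasurableSet S := measurableSet_Ioc.prod measurableSet_Icc
  have hSv : μ S = ENNReal.ofReal (8 / (a * b)) := by
    rw [hS, hμ, Measure.prod_prod, Measure.restrict_apply measurableSet_Ioc,
      inter_eq_left.2 Ioc_subset_Ioi_self, Real.volume_Ioc, Real.volume_Icc,
      ← ENNReal.ofReal_mul (by rw [sub_zero]; positivity)]
    congr 1; field_simp; ring
  have hSv' : μ.real S = 8 / (a * b) := by
    rw [Measure.real, hSv, ENNReal.toReal_ofReal (by positivity)]
  set K : ℝ := (3 * C * a ^ 2) ^ q / q with hK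
  have iS : Integrable (S.indicator fun _ => K) μ :=
    (integrable_indicator_iff hSm).2 (integrableOn_const (by rw [hSv]; exact ENNReal.ofReal_ne_top))
  have hint : ∫ w, S.indicator (fun _ => K) w ∂μ = K * (8 / (a * b)) := by
    rw [integral_indicator hSm, setIntegral_const, hSv', smul_eq_mul, mul_comm]
  have hpos : ∀ᵐ w ∂μ, 0 < w.1 :=
    Measure.quasiMeasurePreserving_fst.ae (ae_restrict_mem measurableSet_Ioi)
  have hle : ∫ w, U w * tricomiCutoff χ a b w ∂μ
      ≤ ∫ w, (1 / p * (|U w| ^ p * φ w) + S.indicator (fun _ => K) w) ∂μ := by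
    refine integral_mono_ae iL ((iN.const_mul _).add iS) ?_
    filter_upwards [hpos] with w hw
    by_cases hwS : w ∈ S
    · rw [indicator_of_mem hwS]
      have hyoung := Real.young_inequality_of_nonneg
        (mul_nonneg (abs_nonneg (U w)) (Real.rpow_nonneg (hφ0 w) (1 / p)))
        (by positivity : 0 ≤ 3 * C * a ^ 2) hpq
      rw [Real.mul_rpow (abs_nonneg _) (Real.rpow_nonneg (hφ0 w) _), ← Real.rpow_mul (hφ0 w),
        one_div_mul_cancel hp0.ne', Real.rpow_one] at hyoung
      calc U w * tricomiCutoff χ a b w ≤ |U w| * |tricomiCutoff χ a b w| := by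
            rw [← abs_mul]; exact le_abs_self _
        _ ≤ |U w| * (3 * C * a ^ 2 * φ w ^ (1 / p)) := by
            gcongr
            exact abs_tricomiCutoff_le hp hχ0 hχ1 hχ2 hC hχC ha hab hw.le
        _ = |U w| * φ w ^ (1 / p) * (3 * C * a ^ 2) := by ring
        _ ≤ _ := hyoung.trans_eq (by rw [hK]; ring)
    · have hout : 2 / a ≤ |w.1| ∨ 2 / b ≤ |w.2| := by
        by_contra! hcon
        exact hwS ⟨⟨hw, (le_abs_self _).trans hcon.1.le⟩, abs_le.1 hcon.2.le⟩
      rw [hLzero w hout, hzero w hout, indicator_of_notMem hwS]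
      simp
  rw [integral_add (iN.const_mul _) iS, integral_const_mul, hint] at hle
  have hI : 0 ≤ ∫ w, |U w| ^ p * φ w ∂μ :=
    integral_nonneg fun w => mul_nonneg (Real.rpow_nonneg (abs_nonneg _) _) (hφ0 w)
  have hp' : 1 / p ≤ 1 := by rw [div_le_one hp0]; exact hp.le
  have := mul_le_of_le_one_left hI hp'
  linarith

theorem theorem1p2 (p : ℝ) (hp1 : 1 < p) (hp5 : p < 5) (u₀ u₁ : ℝ → ℝ)
    (hu₀ : ContDiff ℝ ∞ u₀) (hu₁ : ContDiff ℝ ∞ u₁)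
    (hc₀ : HasCompactSupport u₀) (hc₁ : HasCompactSupport u₁)
    (hnn₀ : ∀ x, 0 ≤ u₀ x) (hnn₁ : ∀ x, 0 ≤ u₁ x)
    (hne₀ : ∃ x, u₀ x ≠ 0) (hne₁ : ∃ x, u₁ x ≠ 0) :
    ¬ ∃ u : ℝ → H1R, IsGlobalWeakSolution p u₀ u₁ u := by
  rintro ⟨u, hu⟩
  obtain ⟨χ, hχ, hχ0, hχ1, hχ11, hχ2, C, hC, hχC⟩ := exists_cutoff hp1
  have hpq : p.HolderConjugate (p.conjExponent) := Real.HolderConjugate.conjExponent hp1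
  set q := p.conjExponent with hq
  have hq0 : 0 < q := hpq.symm.pos
  -- The exponent `5` enters here: `4 q > 5` exactly when `p < 5`.
  have hq5 : 0 < 4 * q - 5 := by
    have : 5 / 4 < q := by
      rw [hq, Real.conjExponent, lt_div_iff₀ (by linarith)]; linarith
    linarith
  obtain ⟨R, hR⟩ := hc₁.isCompact.isBounded.subset_closedBall 0
  have hpos : 0 < ∫ x, u₁ x := by
    obtain ⟨x, hx⟩ := hne₁
    exact hu₁.continuous.integral_pos_of_hasCompactSupport_nonneg_nonzero hc₁ hnn₁ hx
  have hbound : ∀ ε : ℝ, 0 < ε → ε ^ 3 * (|R| + 1) ≤ 1 →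
      ∫ x, u₁ x ≤ 8 * (3 * C) ^ q / q * ε ^ (4 * q - 5) := by
    intro ε hε hεR
    refine (integral_initial_velocity_le hpq hχ hχ0 hχ1 hχ11 hχ2 hC hχC (a := ε ^ 2) (b := ε ^ 3)
      (by positivity) (by positivity) (by ring) hu fun x hx => ?_).trans_eq ?_
    · have hxR : |x| ≤ R := by simpa using hR (subset_tsupport _ hx)
      rw [abs_mul, abs_of_pos (by positivity : 0 < ε ^ 3)]
      refine le_trans ?_ hεR
      gcongr
      linarith [le_abs_self R]
    · rw [Real.mul_rpow (by positivity) (by positivity), Real.rpow_sub hε,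
        Real.rpow_mul hε.le, show (ε ^ 2) ^ 2 = ε ^ 4 by ring, show (ε ^ 2 * ε ^ 3) = ε ^ 5 by ring]
      norm_cast
      ring
  have hlim : Filter.Tendsto (fun ε : ℝ => 8 * (3 * C) ^ q / q * ε ^ (4 * q - 5))
      (nhdsWithin 0 (Ioi 0)) (nhds 0) := by
    have h : Filter.Tendsto (fun ε : ℝ => 8 * (3 * C) ^ q / q * ε ^ (4 * q - 5)) (nhds 0)
        (nhds (8 * (3 * C) ^ q / q * (0 : ℝ) ^ (4 * q - 5))) :=
      ((Real.continuousAt_rpow_const _ _ (Or.inr hq5.le)).tendsto).const_mul _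
    rw [Real.zero_rpow hq5.ne', mul_zero] at h
    exact h.mono_left nhdsWithin_le_nhds
  have hsmall : ∀ᶠ ε in nhdsWithin (0 : ℝ) (Ioi 0), ε ^ 3 * (|R| + 1) ≤ 1 := by
    have h : Continuous fun ε : ℝ => ε ^ 3 * (|R| + 1) := by fun_prop
    have h0 := h.tendsto 0
    simp only [ne_eq, OfNat.ofNat_ne_zero, not_false_eq_true, zero_pow, zero_mul] at h0
    exact ((h0.mono_left nhdsWithin_le_nhds).eventually (gt_mem_nhds one_pos)).mono
      fun _ h => le_of_lt h
  refine hpos.not_ge (ge_of_tendsto hlim ?_)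
  filter_upwards [hsmall, self_mem_nhdsWithin] with ε h1 h2
  exact hbound ε h2 h1
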